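/- Conventions. A map $\varphi:\mathbb R^m\to\mathbb R^n$ is quadratic if all its components are homogeneous polynomials of degree $2$ (or zero) in the coordinates. A smooth map $\varphi: M\to N$ of Riemannian manifolds is a harmonic morphism if for every open $V\subset N$ and every harmonic function $f:V\to\mathbb R$ the function $f\circ\varphi$ is harmonic on $\varphi^{-1}(V)$. A quadratic harmonic morphism is a non-constant quadratic map that is a harmonic morphism. A Clifford system $(P_0,P_1,P_2)$ on $\mathbb R^4$ consists of symmetric endomorphisms of $\mathbb R^4$ with $P_iP_j+P_jP_i=2\delta_{ij}I$; it is irreducible if $\mathbb R^4$ is not a direct sum of two non-zero subspaces that are invariant under all $P_i$. Two such systems $P$ and $Q$ are algebraically equivalent if there is $A\in O(4)$ with $Q_i=AP_iA^t$ for all $i$. Two maps $\psi,\tilde\psi:S^3\to S^2$ of unit spheres are bi-equivalent if $\psi=G^{-1}\circ\tilde\psi\circ P$ for an isometry $P$ of $S^3$ and an isometry $G$ of $S^2$. The standard Hopf fibration $S^3\to S^2$ is the restriction to $S^3$ of $$\varphi_0(x)=\bigl(x_1^2+x_2^2-x_3^2-x_4^2,\ 2x_1x_3+2x_2x_4,\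 -2x_1x_4+2x_2x_3\bigr).$$ **Corollary 3.6.** (1) Let $\varphi:\mathbb R^4\to\mathbb R^3$ be a quadratic harmonic morphism. Then there are $r>0$ and an irreducible Clifford system $(P_0,P_1,P_2)$ on $\mathbb R^4$ such that $$\varphi(rx)=\bigl(\langle P_0x,x\rangle,\langle P_1x,x\rangle,\langle P_2x,x\rangle\bigr)\qquad\text{for all }x\in\mathbb R^4,$$ and, for the same $r$, the map $x\mapsto\varphi(rx)$ restricts to a harmonic morphism $S^3\to S^2$ of the round unit spheres that is bi-equivalent to the standard Hopf fibration. (2) All Clifford systems that arise in this way are algebraically equivalent: if $\varphi,\varphi':\mathbb R^4\to\mathbb R^3$ are quadratic harmonic morphisms, $r,r'>0$, and $P,P'$ are Clifford systems with $\varphi(rx)=(\langle P_ix,x\rangle)_{i=0,1,2}$ and $\varphi'(r'x)=(\langle P'_ix,x\rangle)_{i=0,1,2}$ for all $x\in\mathbb R^4$, then $P$ and $P'$ are algebraically equivalent. -/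

import Mathlib

noncomputable section

open InnerProductSpace Metric Module
open scoped ContDiff Manifold

/-- A map `ℝᵐ → ℝⁿ` is quadratic if each of its components is a quadratic form (a homogeneous
polynomial of degree two) in the coordinates. -/
def IsQuadratic {m n : ℕ} (φ : EuclideanSpace ℝ (Fin m) → EuclideanSpace ℝ (Fin n)) : Prop :=
  ∀ i : Fin n, ∃ p : MvPolynomial (Fin m) ℝ,
    p.IsHomogeneous 2 ∧ ∀ x : EuclideanSpace ℝ (Fin m), φ x i = MvPolynomial.eval (fun j => x j) p

/-- A smooth map between Euclidean spaces is a harmonic morphism if it pulls back every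
(locally defined) harmonic function to a harmonic function. -/
def IsHarmonicMorphism {m n : ℕ}
    (φ : EuclideanSpace ℝ (Fin m) → EuclideanSpace ℝ (Fin n)) : Prop :=
  ContDiff ℝ ∞ φ ∧
    ∀ (V : Set (EuclideanSpace ℝ (Fin n))) (f : EuclideanSpace ℝ (Fin n) → ℝ),
      IsOpen V → HarmonicOnNhd f V → HarmonicOnNhd (f ∘ φ) (φ ⁻¹' V)

/-- Quadratic harmonic morphisms; they are non-constant by convention (the zero form does not
count as a form of degree two). -/
structure IsQuadraticHarmonicMorphism {m n : ℕ}
    (φ : EuclideanSpace ℝ (Fin m) → EuclideanSpace ℝ (Fin n)) : Prop where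
  isQuadratic : IsQuadratic φ
  isHarmonicMorphism : IsHarmonicMorphism φ
  nonconstant : ∃ x y, φ x ≠ φ y

/-- The unit sphere `Sⁿ` in `ℝⁿ⁺¹`. -/
abbrev UnitSphere (n : ℕ) : Type := sphere (0 : EuclideanSpace ℝ (Fin (n + 1))) 1

/-- The extension `y ↦ f (y / ‖y‖)` of a function on the unit sphere which is constant along
rays (with value `0` at the origin). -/
def radialExtension {n : ℕ} (f : UnitSphere n → ℝ) (y : EuclideanSpace ℝ (Fin (n + 1))) : ℝ :=
  open Classical in
  if hy : y = 0 then 0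
  else f ⟨‖y‖⁻¹ • y, by simp [norm_smul, hy]⟩

/-- `f : Sⁿ → ℝ` is harmonic on the set `V` (meant to be open), for the round metric.
The Laplace--Beltrami operator of the unit sphere is
`(Δ_{Sⁿ} f)(x) = (Δ F)(x)` for `x ∈ Sⁿ`, where `F` is the radial extension of `f` and `Δ` is the
Laplacian of `ℝⁿ⁺¹`; moreover `(Δ F)(t x) = t⁻² (Δ F)(x)` for `t > 0`, and `F` is `C²` near
`x` exactly if `f` is. -/
def SphereHarmonicOn {n : ℕ} (f : UnitSphere n → ℝ) (V : Set (UnitSphere n)) : Prop :=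
  ∀ x ∈ V, HarmonicAt (radialExtension f) (x : EuclideanSpace ℝ (Fin (n + 1)))

/-- A smooth map between unit spheres is a harmonic morphism if it pulls back every
(locally defined) harmonic function to a harmonic function. -/
def IsSphereHarmonicMorphism {m n : ℕ} (ψ : UnitSphere m → UnitSphere n) : Prop :=
  ContMDiff (𝓡 m) (𝓡 n) ∞ ψ ∧
    ∀ (V : Set (UnitSphere n)) (f : UnitSphere n → ℝ),
      IsOpen V → SphereHarmonicOn f V → SphereHarmonicOn (f ∘ ψ) (ψ ⁻¹' V)

/-- Bi-equivalence `ψ = G⁻¹ ∘ ψ' ∘ P` of maps, with isometries `P` and `G`. On unit spheres the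
metric of Mathlib is the chordal one; it has the same isometries as the great circle distance,
i.e. as the round Riemannian metric. -/
def BiEquivalent {X Y : Type*} [MetricSpace X] [MetricSpace Y] (ψ ψ' : X → Y) : Prop :=
  ∃ (P : X ≃ᵢ X) (G : Y ≃ᵢ Y), ψ = G.symm ∘ ψ' ∘ P

/-- A tuple of symmetric endomorphisms of `ℝᵈ` is a Clifford system if
`Pᵢ Pⱼ + Pⱼ Pᵢ = 2 δᵢⱼ I`. -/
structure IsCliffordSystem {k d : ℕ} (P : Fin k → End ℝ (EuclideanSpace ℝ (Fin d))) : Prop where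
  isSymmetric : ∀ i, (P i).IsSymmetric
  anticomm : ∀ i j, P i * P j + P j * P i = if i = j then (2 : ℝ) • 1 else 0

/-- A tuple of endomorphisms is irreducible if the space is not the direct sum of two non-zero
subspaces each of which is invariant under all of them. -/
def IsIrreducibleSystem {k d : ℕ} (P : Fin k → End ℝ (EuclideanSpace ℝ (Fin d))) : Prop :=
  ¬ ∃ U W : Submodule ℝ (EuclideanSpace ℝ (Fin d)), U ≠ ⊥ ∧ W ≠ ⊥ ∧ IsCompl U W ∧
    ∀ i, (∀ x ∈ U, P i x ∈ U) ∧ (∀ x ∈ W, P i x ∈ W)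

/-- Algebraic equivalence `Qᵢ = A Pᵢ Aᵗ` with one orthogonal map `A` (so `Aᵗ = A⁻¹`). -/
def AlgebraicallyEquivalent {k d : ℕ} (P Q : Fin k → End ℝ (EuclideanSpace ℝ (Fin d))) : Prop :=
  ∃ A : EuclideanSpace ℝ (Fin d) ≃ₗᵢ[ℝ] EuclideanSpace ℝ (Fin d),
    ∀ i x, Q i x = A (P i (A.symm x))

/-- The map `X ↦ (⟨P₀ X, X⟩, …, ⟨Pₙ X, X⟩)`. -/
def cliffordMap {k d : ℕ} (P : Fin k → End ℝ (EuclideanSpace ℝ (Fin d)))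
    (x : EuclideanSpace ℝ (Fin d)) : EuclideanSpace ℝ (Fin k) :=
  WithLp.toLp 2 fun i => inner ℝ (P i x) x

/-- The standard Hopf construction map `ℝ⁴ → ℝ³`. -/
def hopfMap (x : EuclideanSpace ℝ (Fin 4)) : EuclideanSpace ℝ (Fin 3) :=
  !₂[x 0 ^ 2 + x 1 ^ 2 - x 2 ^ 2 - x 3 ^ 2,
    2 * x 0 * x 2 + 2 * x 1 * x 3,
    -2 * x 0 * x 3 + 2 * x 1 * x 2]

theorem norm_hopfMap (x : EuclideanSpace ℝ (Fin 4)) : ‖hopfMap x‖ = ‖x‖ ^ 2 := by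
  have h : ‖hopfMap x‖ ^ 2 = (‖x‖ ^ 2) ^ 2 := by
    simp [EuclideanSpace.norm_sq_eq, hopfMap, Fin.sum_univ_succ]
    ring
  exact (pow_left_inj₀ (norm_nonneg _) (by positivity) two_ne_zero).1 h

/-- The standard Hopf fibration `S³ → S²`, the restriction of the Hopf construction map. -/
def hopfFibration (x : UnitSphere 3) : UnitSphere 2 :=
  ⟨hopfMap x, by simp [norm_hopfMap]⟩

end

/-!
A harmonic morphism pulls back the harmonic functions `⟪a, ·⟫` and `⟪a, ·⟫ * ⟪b, ·⟫` with `a ⊥ b`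
to harmonic functions, so the product rule for the Laplacian makes the gradients of `⟪a, φ ·⟫` and
`⟪b, φ ·⟫` orthogonal. For `φ x = (⟪A₀ x, x⟫, ⟪A₁ x, x⟫, ⟪A₂ x, x⟫)` with symmetric `Aᵢ` these
gradients are linear in `x`, and orthogonality says that the `Aᵢ` anticommute pairwise and have a
common square.

Let `P₀`, `P₁`, `P₂` be such endomorphisms of `ℝ⁴` and `P₀² u = u` for some `u ≠ 0`. Then one of
`u + P₀ u` and `P₁ u` is a non-zero fixed vector of `P₀`, and a fixed unit vector `v` generates the
orthonormal basis `v, P₂ P₁ v, P₁ v, -P₂ v`, in which the `Pᵢ` have the matrices of the Hopf map.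
Hence an invariant subspace containing `u` is everything. Applied to `{x | P₀² x = x}` this shows
that the common square is the identity, so that `|μ|⁻¹ Aᵢ` is a Clifford system for each non-zero
eigenvalue `μ` of `A₀`; it also gives irreducibility, and the basis gives the equivalence of every
Clifford system with the one of the Hopf map.
-/

open InnerProductSpace Module Laplacian Gradient
open scoped ContDiff Manifold Topology RealInnerProductSpace

section Gradient

variable {E : Type*} [NormedAddCommGroup E] [InnerProductSpace ℝ E] [CompleteSpace E]

theorem hasGradientAt_inner_right (a x : E) : HasGradientAt (fun y => ⟪a, y⟫) a x :=
  (innerSL ℝ a).hasFDerivAt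

theorem hasGradientAt_inner_map_self {T : E →L[ℝ] E} (hT : (T : E →ₗ[ℝ] E).IsSymmetric) (x : E) :
    HasGradientAt (fun y => ⟪T y, y⟫) ((2 : ℝ) • T x) x := by
  have toDual_eq : InnerProductSpace.toDual ℝ E ((2 : ℝ) • T x) = 2 • innerSL ℝ (T x) := by
    ext v
    simp [two_smul]
  rw [hasGradientAt_iff_hasFDerivAt, toDual_eq]
  exact (hT.hasStrictFDerivAt_reApplyInnerSelf x).hasFDerivAt

end Gradient

section Laplacian

variable {E : Type*} [NormedAddCommGroup E] [InnerProductSpace ℝ E] [FiniteDimensional ℝ E]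
  {F : Type*} [NormedAddCommGroup F] [NormedSpace ℝ F]

theorem laplacian_eq_sum_fderiv_fderiv {ι : Type*} [Fintype ι] (b : OrthonormalBasis ι ℝ E)
    (f : E → F) (x : E) : Δ f x = ∑ i, fderiv ℝ (fderiv ℝ f) x (b i) (b i) := by
  simp [laplacian_eq_iteratedFDeriv_orthonormalBasis f b, iteratedFDeriv_two_apply]

theorem laplacian_mul [CompleteSpace E] {f g : E → ℝ} {x : E} (hf : ContDiffAt ℝ 2 f x)
    (hg : ContDiffAt ℝ 2 g x) :
    Δ (fun y => f y * g y) x = f x * Δ g x + 2 * ⟪∇ f x, ∇ g x⟫ + g x * Δ f x := by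
  have differentiable_near {h : E → ℝ} (hh : ContDiffAt ℝ 2 h x) :
      ∀ᶠ y in 𝓝 x, DifferentiableAt ℝ h y :=
    (hh.eventually (by simp)).mono fun y hy => hy.differentiableAt two_ne_zero
  have hasFDerivAt_fderiv {h : E → ℝ} (hh : ContDiffAt ℝ 2 h x) :
      HasFDerivAt (fderiv ℝ h) (fderiv ℝ (fderiv ℝ h) x) x :=
    ((hh.fderiv_right (m := 1) (by norm_num)).differentiableAt one_ne_zero).hasFDerivAt
  have fderiv_mul : fderiv ℝ (fun y => f y * g y) =ᶠ[𝓝 x]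
      fun y => f y • fderiv ℝ g y + g y • fderiv ℝ f y := by
    filter_upwards [differentiable_near hf, differentiable_near hg] with y hfy hgy
    exact fderiv_fun_mul hfy hgy
  have fderiv_fderiv_mul := fderiv_mul.fderiv_eq.trans
    (((differentiable_near hf).self_of_nhds.hasFDerivAt.smul (hasFDerivAt_fderiv hg)).add
      ((differentiable_near hg).self_of_nhds.hasFDerivAt.smul (hasFDerivAt_fderiv hf))).fderiv
  let b := stdOrthonormalBasis ℝ E
  simp only [laplacian_eq_sum_fderiv_fderiv b, fderiv_fderiv_mul,
    ← b.sum_inner_mul_inner (∇ f x) (∇ g x), Finset.mul_sum, ← Finset.sum_add_distrib,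
    real_inner_comm (∇ g x), inner_gradient_left]
  refine Finset.sum_congr rfl fun i _ => ?_
  simp
  ring

theorem laplacian_comp_smul (c : ℝ) (f : E → F) (x : E) :
    Δ (fun y => f (c • y)) x = c ^ 2 • Δ f (c • x) := by
  have fderiv_comp : fderiv ℝ (fun y => f (c • y)) = c • fun y => fderiv ℝ f (c • y) :=
    funext fun y => fderiv_comp_smul c
  have fderiv_fderiv_comp : fderiv ℝ (c • fun y => fderiv ℝ f (c • y)) x =
      c • c • fderiv ℝ (fderiv ℝ f) (c • x) :=
    (congrFun (fderiv_const_smul_field (f := fun y => fderiv ℝ f (c • y)) c) x).trans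
      (congrArg (c • ·) (fderiv_comp_smul (f := fderiv ℝ f) c))
  simp [laplacian_eq_sum_fderiv_fderiv (stdOrthonormalBasis ℝ E), fderiv_comp, fderiv_fderiv_comp,
    Finset.smul_sum, smul_smul, sq]

theorem harmonicAt_comp_smul {c : ℝ} {f : E → F} {x : E} (hf : HarmonicAt f (c • x)) :
    HarmonicAt (fun y => f (c • y)) x := by
  have tendsto_smul : Filter.Tendsto (c • ·) (𝓝 x) (𝓝 (c • x)) :=
    (continuous_const_smul c).tendsto x
  refine ⟨ContDiffAt.comp x (g := f) hf.1 (contDiff_const_smul c).contDiffAt, ?_⟩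
  filter_upwards [tendsto_smul.eventually hf.2] with y hy
  simp [laplacian_comp_smul, hy]

theorem laplacian_inner_right (a x : E) : Δ (fun y => ⟪a, y⟫) x = 0 := by
  have fderiv_inner : fderiv ℝ (fun y => ⟪a, y⟫) = fun _ => innerSL ℝ a :=
    funext fun y => (innerSL ℝ a).fderiv
  simp [laplacian_eq_sum_fderiv_fderiv (stdOrthonormalBasis ℝ E), fderiv_inner]

theorem harmonicAt_inner_right (a x : E) : HarmonicAt (fun y => ⟪a, y⟫) x :=
  ⟨(innerSL ℝ a).contDiff.contDiffAt, .of_forall (laplacian_inner_right a)⟩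

theorem harmonicAt_inner_mul_inner {a b : E} (hab : ⟪a, b⟫ = 0) (x : E) :
    HarmonicAt (fun y => ⟪a, y⟫ * ⟪b, y⟫) x := by
  have := FiniteDimensional.complete ℝ E
  have contDiffAt_inner (c y : E) : ContDiffAt ℝ 2 (fun y => ⟪c, y⟫) y :=
    (harmonicAt_inner_right c y).1
  refine ⟨(contDiffAt_inner a x).mul (contDiffAt_inner b x), .of_forall fun y => ?_⟩
  simp [laplacian_mul (contDiffAt_inner a y) (contDiffAt_inner b y), laplacian_inner_right,
    (hasGradientAt_inner_right _ y).gradient, hab]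

end Laplacian

namespace IsHarmonicMorphism

variable {l m n : ℕ} {φ : EuclideanSpace ℝ (Fin m) → EuclideanSpace ℝ (Fin n)}

theorem comp {φ' : EuclideanSpace ℝ (Fin l) → EuclideanSpace ℝ (Fin m)}
    (hφ : IsHarmonicMorphism φ) (hφ' : IsHarmonicMorphism φ') : IsHarmonicMorphism (φ ∘ φ') :=
  ⟨hφ.1.comp hφ'.1, fun V f hV hf =>
    hφ'.2 _ (f ∘ φ) (hV.preimage hφ.1.continuous) (hφ.2 V f hV hf)⟩

theorem const_smul (c : ℝ) : IsHarmonicMorphism fun x : EuclideanSpace ℝ (Fin m) => c • x :=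
  ⟨contDiff_const_smul c, fun _ _ _ hf _ hx => harmonicAt_comp_smul (hf _ hx)⟩

theorem harmonicAt_comp (hφ : IsHarmonicMorphism φ) {f : EuclideanSpace ℝ (Fin n) → ℝ}
    (hf : ∀ y, HarmonicAt f y) (x : EuclideanSpace ℝ (Fin m)) : HarmonicAt (f ∘ φ) x :=
  hφ.2 Set.univ f isOpen_univ (fun y _ => hf y) x trivial

/-- Harmonic morphisms are horizontally weakly conformal: the adjoint of the differential, which
sends `a` to the gradient of `⟪a, φ ·⟫`, preserves orthogonality. -/
theorem inner_gradient_eq_zero (hφ : IsHarmonicMorphism φ) {a b : EuclideanSpace ℝ (Fin n)}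
    (hab : ⟪a, b⟫ = 0) (x : EuclideanSpace ℝ (Fin m)) :
    ⟪∇ (fun y => ⟪a, φ y⟫) x, ∇ (fun y => ⟪b, φ y⟫) x⟫ = 0 := by
  have harmonic_inner (c : EuclideanSpace ℝ (Fin n)) : HarmonicAt (fun y => ⟪c, φ y⟫) x :=
    hφ.harmonicAt_comp (harmonicAt_inner_right c) x
  have laplacian_prod : Δ (fun y => ⟪a, φ y⟫ * ⟪b, φ y⟫) x = 0 :=
    (hφ.harmonicAt_comp (harmonicAt_inner_mul_inner hab) x).2.self_of_nhds
  have laplacian_inner (c : EuclideanSpace ℝ (Fin n)) : Δ (fun y => ⟪c, φ y⟫) x = 0 :=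
    (harmonic_inner c).2.self_of_nhds
  simpa [laplacian_mul (harmonic_inner a).1 (harmonic_inner b).1, laplacian_inner]
    using laplacian_prod

end IsHarmonicMorphism

section Quadratic

theorem exists_eval_eq_inner {σ : Type*} [Fintype σ] {p : MvPolynomial σ ℝ}
    (hp : p.IsHomogeneous 1) :
    ∃ a : EuclideanSpace ℝ σ, ∀ x : EuclideanSpace ℝ σ, p.eval (fun j => x j) = ⟪a, x⟫ := by
  classical
  rw [← MvPolynomial.mem_homogeneousSubmodule,
    MvPolynomial.homogeneousSubmodule_one_eq_span_X] at hp
  induction hp using Submodule.span_induction with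
  | mem q hq =>
    obtain ⟨i, rfl⟩ := hq
    exact ⟨EuclideanSpace.single i 1, fun x => by simp [EuclideanSpace.inner_single_left]⟩
  | zero => exact ⟨0, by simp⟩
  | add q r _ _ hq hr =>
    obtain ⟨a, ha⟩ := hq
    obtain ⟨b, hb⟩ := hr
    exact ⟨a + b, fun x => by simp [ha, hb, inner_add_left]⟩
  | smul c q _ hq =>
    obtain ⟨a, ha⟩ := hq
    exact ⟨c • a, fun x => by simp [ha, real_inner_smul_left]⟩

theorem exists_isSymmetric_eval_eq_inner {σ : Type*} [Fintype σ] {p : MvPolynomial σ ℝ}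
    (hp : p.IsHomogeneous 2) :
    ∃ A : End ℝ (EuclideanSpace ℝ σ), A.IsSymmetric ∧
      ∀ x : EuclideanSpace ℝ σ, p.eval (fun j => x j) = ⟪A x, x⟫ := by
  rw [← MvPolynomial.mem_homogeneousSubmodule, ← MvPolynomial.homogeneousSubmodule_one_pow,
    pow_two] at hp
  induction hp using Submodule.mul_induction_on' with
  | mem_mul_mem q hq r hr =>
    obtain ⟨a, ha⟩ := exists_eval_eq_inner hq
    obtain ⟨b, hb⟩ := exists_eval_eq_inner hr
    refine ⟨(2⁻¹ : ℝ) • ((innerₗ _ a).smulRight b + (innerₗ _ b).smulRight a),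
      fun x y => ?_, fun x => ?_⟩
    · simp only [LinearMap.smul_apply, LinearMap.add_apply, LinearMap.smulRight_apply,
        innerₗ_apply_apply, inner_add_left, real_inner_smul_left, real_inner_comm _ x]
      ring
    · simp only [map_mul, ha, hb, LinearMap.smul_apply, LinearMap.add_apply,
        LinearMap.smulRight_apply, innerₗ_apply_apply, inner_add_left, real_inner_smul_left]
      ring
  | add q _ r _ hq hr =>
    obtain ⟨A, hA, hqA⟩ := hq
    obtain ⟨B, hB, hrB⟩ := hr
    exact ⟨A + B, hA.add hB, fun x => by simp [hqA, hrB, inner_add_left]⟩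

theorem IsQuadratic.exists_eq_cliffordMap {m n : ℕ}
    {φ : EuclideanSpace ℝ (Fin m) → EuclideanSpace ℝ (Fin n)} (hφ : IsQuadratic φ) :
    ∃ A : Fin n → End ℝ (EuclideanSpace ℝ (Fin m)),
      (∀ i, (A i).IsSymmetric) ∧ φ = cliffordMap A := by
  choose p hp hφp using hφ
  choose A hA hpA using fun i => exists_isSymmetric_eval_eq_inner (hp i)
  refine ⟨A, hA, funext fun x => ?_⟩
  ext i
  exact (hφp i x).trans (hpA i x)

end Quadratic

section CliffordMap

variable {k d : ℕ} (P : Fin k → End ℝ (EuclideanSpace ℝ (Fin d)))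

theorem cliffordMap_smul (t : ℝ) (x : EuclideanSpace ℝ (Fin d)) :
    cliffordMap P (t • x) = t ^ 2 • cliffordMap P x := by
  ext i
  simp [cliffordMap, real_inner_smul_left, real_inner_smul_right, sq, mul_assoc]

theorem cliffordMap_const_smul (c : ℝ) (x : EuclideanSpace ℝ (Fin d)) :
    cliffordMap (fun i => c • P i) x = c • cliffordMap P x := by
  ext i
  simp [cliffordMap, real_inner_smul_left]

theorem inner_cliffordMap (a : EuclideanSpace ℝ (Fin k)) (x : EuclideanSpace ℝ (Fin d)) :
    ⟪a, cliffordMap P x⟫ = ⟪(∑ i, a i • P i) x, x⟫ := by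
  simp only [PiLp.inner_apply (𝕜 := ℝ) a, cliffordMap, LinearMap.sum_apply, LinearMap.smul_apply,
    sum_inner, real_inner_smul_left]
  exact Finset.sum_congr rfl fun i _ => mul_comm _ _

variable {P}

theorem isSymmetric_sum_smul (hP : ∀ i, (P i).IsSymmetric) (a : EuclideanSpace ℝ (Fin k)) :
    (∑ i, a i • P i).IsSymmetric := fun x y => by
  simp [sum_inner, inner_sum, real_inner_smul_left, real_inner_smul_right, hP _ x y]

theorem gradient_inner_cliffordMap (hP : ∀ i, (P i).IsSymmetric) (a : EuclideanSpace ℝ (Fin k))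
    (x : EuclideanSpace ℝ (Fin d)) :
    ∇ (fun y => ⟪a, cliffordMap P y⟫) x = (2 : ℝ) • (∑ i, a i • P i) x := by
  simp only [inner_cliffordMap]
  exact (hasGradientAt_inner_map_self (T := LinearMap.toContinuousLinearMap (∑ i, a i • P i))
    (isSymmetric_sum_smul hP a) x).gradient

end CliffordMap

theorem apply_apply_eq_neg_of_inner_eq_zero {E : Type*} [NormedAddCommGroup E]
    [InnerProductSpace ℝ E] {S T : End ℝ E} (hS : S.IsSymmetric) (hT : T.IsSymmetric)
    (hST : ∀ x, ⟪S x, T x⟫ = 0) (x : E) : S (T x) = -T (S x) := by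
  refine ext_inner_right ℝ fun y => ?_
  have polarized : ⟪T x, S y⟫ + ⟪S x, T y⟫ = 0 := by
    simpa [inner_add_left, inner_add_right, hST, real_inner_comm (T x) (S y)] using hST (x + y)
  rw [hS, inner_neg_left, hT (S x)]
  exact eq_neg_of_add_eq_zero_left polarized

/-- Symmetric endomorphisms which anticommute pairwise and have a common square. These are the
systems `P` for which the map `x ↦ (⟨Pᵢ x, x⟩)ᵢ` is horizontally weakly conformal; a Clifford system
is one whose common square is the identity. -/
structure IsWeakCliffordSystem {ι E : Type*} [NormedAddCommGroup E] [InnerProductSpace ℝ E]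
    (P : ι → End ℝ E) : Prop where
  isSymmetric : ∀ i, (P i).IsSymmetric
  anticomm : ∀ i j, i ≠ j → ∀ x, P i (P j x) = -P j (P i x)
  sq_eq : ∀ i j x, P i (P i x) = P j (P j x)

theorem IsHarmonicMorphism.isWeakCliffordSystem {k d : ℕ}
    {P : Fin k → End ℝ (EuclideanSpace ℝ (Fin d))} (hφ : IsHarmonicMorphism (cliffordMap P))
    (hP : ∀ i, (P i).IsSymmetric) : IsWeakCliffordSystem P := by
  have anticomm_of_orthogonal {a b : EuclideanSpace ℝ (Fin k)} (hab : ⟪a, b⟫ = 0)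
      (x : EuclideanSpace ℝ (Fin d)) :
      (∑ i, a i • P i) ((∑ i, b i • P i) x) = -(∑ i, b i • P i) ((∑ i, a i • P i) x) := by
    refine apply_apply_eq_neg_of_inner_eq_zero (isSymmetric_sum_smul hP a)
      (isSymmetric_sum_smul hP b) (fun y => ?_) x
    have h := hφ.inner_gradient_eq_zero hab y
    rw [gradient_inner_cliffordMap hP, gradient_inner_cliffordMap hP] at h
    simpa [real_inner_smul_left, real_inner_smul_right] using h
  let e (i : Fin k) : EuclideanSpace ℝ (Fin k) := EuclideanSpace.single i 1
  have sum_e (i : Fin k) : ∑ j, e i j • P j = P i := by simp [e]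
  have anticomm (i j : Fin k) (hij : i ≠ j) (x : EuclideanSpace ℝ (Fin d)) :
      P i (P j x) = -P j (P i x) := by
    simpa [sum_e] using anticomm_of_orthogonal
      (a := e i) (b := e j) (by simp [e, EuclideanSpace.inner_single_left, hij]) x
  refine ⟨hP, anticomm, fun i j x => ?_⟩
  have anticomm_sub_add : (P i - P j) ((P i + P j) x) = -(P i + P j) ((P i - P j) x) := by
    simpa [sum_e, add_smul, sub_smul, Finset.sum_add_distrib, Finset.sum_sub_distrib] using
      anticomm_of_orthogonal (a := e i - e j) (b := e i + e j)
        (by simp [e, inner_sub_left, inner_add_right, real_inner_comm]) x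
  simp only [LinearMap.sub_apply, LinearMap.add_apply, map_add, map_sub] at anticomm_sub_add
  have two_smul_eq : (2 : ℝ) • P i (P i x) = (2 : ℝ) • P j (P j x) := by
    linear_combination (norm := module) anticomm_sub_add
  exact smul_right_injective _ two_ne_zero two_smul_eq

/-- The matrices of the quadratic forms which are the components of the Hopf construction map. -/
def hopfMatrix : Fin 3 → Matrix (Fin 4) (Fin 4) ℝ :=
  ![!![1, 0, 0, 0; 0, 1, 0, 0; 0, 0, -1, 0; 0, 0, 0, -1],
    !![0, 0, 1, 0; 0, 0, 0, 1; 1, 0, 0, 0; 0, 1, 0, 0],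
    !![0, 0, 0, -1; 0, 0, 1, 0; 0, 1, 0, 0; -1, 0, 0, 0]]

/-- The Clifford system of the Hopf construction map. -/
noncomputable def hopfSystem (i : Fin 3) : End ℝ (EuclideanSpace ℝ (Fin 4)) :=
  Matrix.toEuclideanLin (hopfMatrix i)

theorem cliffordMap_hopfSystem : cliffordMap hopfSystem = hopfMap := by
  ext x i
  fin_cases i <;>
    simp [cliffordMap, hopfMap, hopfSystem, hopfMatrix, Matrix.toLpLin_apply, PiLp.inner_apply,
      Fin.sum_univ_four, Matrix.vecHead, Matrix.vecTail] <;>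
    ring

namespace IsWeakCliffordSystem

variable {ι E : Type*} [NormedAddCommGroup E] [InnerProductSpace ℝ E]

section Basic

variable {P : ι → End ℝ E}

theorem smul (hP : IsWeakCliffordSystem P) (c : ℝ) : IsWeakCliffordSystem fun i => c • P i where
  isSymmetric i := (hP.isSymmetric i).smul (by simp)
  anticomm i j hij x := by simp [hP.anticomm i j hij x]
  sq_eq i j x := by simp [hP.sq_eq i j x]

theorem norm_apply_eq (hP : IsWeakCliffordSystem P) (i j : ι) (x : E) : ‖P i x‖ = ‖P j x‖ := by
  rw [norm_eq_sqrt_real_inner, norm_eq_sqrt_real_inner (P j x), hP.isSymmetric, hP.isSymmetric,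
    hP.sq_eq i j]

theorem inner_apply_apply_eq_zero (hP : IsWeakCliffordSystem P) {i j : ι} (hij : i ≠ j) (x : E) :
    ⟪P i x, P j x⟫ = 0 := by
  have inner_eq_neg : ⟪P i x, P j x⟫ = -⟪P i x, P j x⟫ := by
    calc ⟪P i x, P j x⟫ = ⟪x, P i (P j x)⟫ := hP.isSymmetric i _ _
      _ = -⟪P j x, P i x⟫ := by rw [hP.anticomm i j hij, inner_neg_right, ← hP.isSymmetric j]
      _ = -⟪P i x, P j x⟫ := by rw [real_inner_comm]
  exact self_eq_neg.1 inner_eq_neg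

end Basic

variable {P : Fin 3 → End ℝ E}

/-- The frame of a four-dimensional space generated by a unit vector `v` with `P 0 v = v`. Its
signs and order are those for which a Clifford system has the matrices `hopfMatrix`. -/
def frame (P : Fin 3 → End ℝ E) (v : E) : Fin 4 → E :=
  ![v, P 2 (P 1 v), P 1 v, -P 2 v]

theorem orthonormal_frame (hP : IsWeakCliffordSystem P) {v : E} (hv : P 0 v = v)
    (hv1 : ‖v‖ = 1) : Orthonormal ℝ (frame P v) := by
  have apply_zero_one : P 0 (P 1 v) = -P 1 v := by rw [hP.anticomm 0 1 (by decide), hv]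
  have norm_apply (i : Fin 3) : ‖P i v‖ = 1 := by rw [hP.norm_apply_eq i 0, hv, hv1]
  have norm_two_one : ‖P 2 (P 1 v)‖ = 1 := by
    rw [hP.norm_apply_eq 2 0, apply_zero_one, norm_neg, norm_apply]
  have inner_self_apply {i : Fin 3} (hi : 0 ≠ i) : ⟪v, P i v⟫ = 0 := by
    simpa [hv] using hP.inner_apply_apply_eq_zero hi v
  have inner_one_two : ⟪P 1 v, P 2 v⟫ = 0 := hP.inner_apply_apply_eq_zero (by decide) v
  have inner_self_two_one : ⟪v, P 2 (P 1 v)⟫ = 0 := by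
    rw [← hP.isSymmetric, real_inner_comm, inner_one_two]
  have inner_two_one_one : ⟪P 2 (P 1 v), P 1 v⟫ = 0 := by
    simpa [apply_zero_one] using hP.inner_apply_apply_eq_zero (i := 2) (j := 0) (by decide) (P 1 v)
  have inner_two_one_two : ⟪P 2 (P 1 v), P 2 v⟫ = 0 := by
    rw [hP.isSymmetric, hP.sq_eq 2 0, hv, hv, real_inner_comm, inner_self_apply (by decide)]
  simp [frame, orthonormal_vecCons_iff, Fin.forall_fin_succ, *]

theorem apply_frame (hP : IsWeakCliffordSystem P) {v : E} (hv : P 0 v = v) (i : Fin 3)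
    (j : Fin 4) : P i (frame P v j) = ∑ k, hopfMatrix i k j • frame P v k := by
  have apply_apply (i : Fin 3) : P i (P i v) = v := by rw [hP.sq_eq i 0, hv, hv]
  have apply_zero {i : Fin 3} (hi : 0 ≠ i) : P 0 (P i v) = -P i v := by
    rw [hP.anticomm 0 i hi, hv]
  have zero_two_one : P 0 (P 2 (P 1 v)) = P 2 (P 1 v) := by
    rw [hP.anticomm 0 2 (by decide), apply_zero (by decide), map_neg, neg_neg]
  have one_two : P 1 (P 2 v) = -P 2 (P 1 v) := hP.anticomm 1 2 (by decide) v
  have one_two_one : P 1 (P 2 (P 1 v)) = -P 2 v := by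
    rw [hP.anticomm 1 2 (by decide), apply_apply]
  have two_two_one : P 2 (P 2 (P 1 v)) = P 1 v := by rw [hP.sq_eq 2 1, apply_apply]
  fin_cases i <;> fin_cases j <;>
    simp [frame, hopfMatrix, Fin.sum_univ_four, hv, apply_apply, apply_zero, zero_two_one,
      one_two, one_two_one, two_two_one]

theorem span_frame_eq_top (hP : IsWeakCliffordSystem P) (hE : finrank ℝ E = 4) {v : E}
    (hv : P 0 v = v) (hv1 : ‖v‖ = 1) : Submodule.span ℝ (Set.range (frame P v)) = ⊤ :=
  (hP.orthonormal_frame hv hv1).linearIndependent.span_eq_top_of_card_eq_finrank (by simp [hE])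

theorem exists_fixed_unit_mem (hP : IsWeakCliffordSystem P) {U : Submodule ℝ E}
    (hU : ∀ i, ∀ x ∈ U, P i x ∈ U) {u : E} (huU : u ∈ U) (hu : u ≠ 0) (hsq : P 0 (P 0 u) = u) :
    ∃ v ∈ U, ‖v‖ = 1 ∧ P 0 v = v := by
  suffices exists_fixed : ∃ v ∈ U, v ≠ 0 ∧ P 0 v = v by
    obtain ⟨v, hvU, hv, hfix⟩ := exists_fixed
    exact ⟨‖v‖⁻¹ • v, U.smul_mem _ hvU, by simp [norm_smul, hv], by simp [hfix]⟩
  by_cases hneg : u + P 0 u = 0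
  · have apply_zero : P 0 u = -u := eq_neg_of_add_eq_zero_right hneg
    refine ⟨P 1 u, hU 1 u huU, fun h => hu ?_, ?_⟩
    · rw [← hsq, hP.sq_eq 0 1, h, map_zero]
    · rw [hP.anticomm 0 1 (by decide), apply_zero, map_neg, neg_neg]
  · exact ⟨u + P 0 u, U.add_mem huU (hU 0 u huU), hneg, by rw [map_add, hsq, add_comm]⟩

theorem eq_top_of_invariant (hP : IsWeakCliffordSystem P) (hE : finrank ℝ E = 4)
    {U : Submodule ℝ E} (hU : ∀ i, ∀ x ∈ U, P i x ∈ U) {u : E} (huU : u ∈ U) (hu : u ≠ 0)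
    (hsq : P 0 (P 0 u) = u) : U = ⊤ := by
  obtain ⟨v, hvU, hv1, hv⟩ := hP.exists_fixed_unit_mem hU huU hu hsq
  rw [← top_le_iff, ← hP.span_frame_eq_top hE hv hv1, Submodule.span_le, Set.range_subset_iff]
  simp [frame, Fin.forall_fin_succ, hvU, hU]

theorem apply_apply_eq_self (hP : IsWeakCliffordSystem P) (hE : finrank ℝ E = 4) {u : E}
    (hu : u ≠ 0) (hsq : P 0 (P 0 u) = u) (i : Fin 3) (x : E) : P i (P i x) = x := by
  have fixed_invariant (j : Fin 3) (y : E) (hy : P 0 (P 0 y) = y) :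
      P 0 (P 0 (P j y)) = P j y := by
    rw [hP.sq_eq 0 j, hP.sq_eq j 0 y, hy]
  have eqLocus_eq_top : LinearMap.eqLocus (P 0 * P 0) 1 = ⊤ :=
    hP.eq_top_of_invariant hE fixed_invariant hsq hu hsq
  rw [hP.sq_eq i 0]
  exact LinearMap.congr_fun (LinearMap.eqLocus_eq_top.1 eqLocus_eq_top) x

end IsWeakCliffordSystem

theorem isCliffordSystem_iff {k d : ℕ} {P : Fin k → End ℝ (EuclideanSpace ℝ (Fin d))} :
    IsCliffordSystem P ↔ IsWeakCliffordSystem P ∧ ∀ i x, P i (P i x) = x := by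
  refine ⟨fun hP => ?_, fun ⟨hP, hsq⟩ => ⟨hP.isSymmetric, fun i j => ?_⟩⟩
  · have hsq (i : Fin k) (x : EuclideanSpace ℝ (Fin d)) : P i (P i x) = x := by
      have h := LinearMap.congr_fun (hP.anticomm i i) x
      rw [if_pos rfl, ← two_smul ℝ] at h
      exact smul_right_injective _ (two_ne_zero (α := ℝ)) h
    refine ⟨⟨hP.isSymmetric, fun i j hij x => ?_, fun i j x => by rw [hsq, hsq]⟩, hsq⟩
    have h := LinearMap.congr_fun (hP.anticomm i j) x
    rw [if_neg hij] at h
    exact eq_neg_of_add_eq_zero_left h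
  · ext1 x
    split_ifs with hij
    · subst hij
      simp [hsq, two_smul]
    · simp [hP.anticomm i j hij]

theorem exists_eigenvector_ne_zero {E : Type*} [NormedAddCommGroup E] [InnerProductSpace ℝ E]
    [FiniteDimensional ℝ E] {T : End ℝ E} (hT : T.IsSymmetric) (hT0 : T ≠ 0) :
    ∃ μ : ℝ, μ ≠ 0 ∧ ∃ u ≠ 0, T u = μ • u := by
  let b := hT.eigenvectorBasis rfl
  obtain ⟨i, hi⟩ : ∃ i, hT.eigenvalues rfl i ≠ 0 := by
    by_contra! eigenvalues_eq_zero
    refine hT0 (b.toBasis.ext fun i => ?_)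
    simp [b, hT.apply_eigenvectorBasis, eigenvalues_eq_zero]
  exact ⟨_, hi, b i, b.orthonormal.ne_zero i, hT.apply_eigenvectorBasis rfl i⟩

theorem IsWeakCliffordSystem.exists_isCliffordSystem_smul
    {A : Fin 3 → End ℝ (EuclideanSpace ℝ (Fin 4))} (hA : IsWeakCliffordSystem A) (hA0 : A 0 ≠ 0) :
    ∃ c : ℝ, 0 < c ∧ IsCliffordSystem fun i => c • A i := by
  obtain ⟨μ, hμ, u, hu, hAu⟩ := exists_eigenvector_ne_zero (hA.isSymmetric 0) hA0
  have hsq : (|μ|⁻¹ • A 0) ((|μ|⁻¹ • A 0) u) = u := by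
    have sign_sq : |μ|⁻¹ * μ * (|μ|⁻¹ * μ) = 1 := by
      rw [mul_mul_mul_comm, ← abs_mul_abs_self μ]
      field_simp
    simp only [LinearMap.smul_apply, hAu, map_smul, smul_smul, sign_sq, one_smul]
  have hcA := hA.smul |μ|⁻¹
  exact ⟨|μ|⁻¹, by positivity,
    isCliffordSystem_iff.2 ⟨hcA, hcA.apply_apply_eq_self (by simp) hu hsq⟩⟩

theorem IsQuadraticHarmonicMorphism.exists_isCliffordSystem
    {φ : EuclideanSpace ℝ (Fin 4) → EuclideanSpace ℝ (Fin 3)}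
    (hφ : IsQuadraticHarmonicMorphism φ) :
    ∃ r : ℝ, 0 < r ∧ ∃ P : Fin 3 → End ℝ (EuclideanSpace ℝ (Fin 4)),
      IsCliffordSystem P ∧ ∀ x, φ (r • x) = cliffordMap P x := by
  obtain ⟨A, hAsymm, rfl⟩ := hφ.isQuadratic.exists_eq_cliffordMap
  have hA := hφ.isHarmonicMorphism.isWeakCliffordSystem hAsymm
  have hA0 : A 0 ≠ 0 := by
    intro hA0
    have apply_eq_zero (i : Fin 3) (x : EuclideanSpace ℝ (Fin 4)) : A i x = 0 := by
      rw [← norm_eq_zero, hA.norm_apply_eq i 0, hA0, LinearMap.zero_apply, norm_zero]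
    obtain ⟨x, y, hxy⟩ := hφ.nonconstant
    exact hxy (by simp [cliffordMap, apply_eq_zero])
  obtain ⟨c, hc, hcA⟩ := hA.exists_isCliffordSystem_smul hA0
  refine ⟨√c, Real.sqrt_pos.2 hc, _, hcA, fun x => ?_⟩
  rw [cliffordMap_smul, cliffordMap_const_smul, Real.sq_sqrt hc.le]

namespace AlgebraicallyEquivalent

variable {k d : ℕ} {P Q R : Fin k → End ℝ (EuclideanSpace ℝ (Fin d))}

theorem symm (h : AlgebraicallyEquivalent P Q) : AlgebraicallyEquivalent Q P := by
  obtain ⟨A, hA⟩ := h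
  exact ⟨A.symm, fun i x => by simp [hA]⟩

theorem trans (h : AlgebraicallyEquivalent P Q) (h' : AlgebraicallyEquivalent Q R) :
    AlgebraicallyEquivalent P R := by
  obtain ⟨A, hA⟩ := h
  obtain ⟨B, hB⟩ := h'
  exact ⟨A.trans B, fun i x => by simp [hA, hB]⟩

theorem exists_cliffordMap_eq (h : AlgebraicallyEquivalent P Q) :
    ∃ A : EuclideanSpace ℝ (Fin d) ≃ₗᵢ[ℝ] EuclideanSpace ℝ (Fin d),
      ∀ x, cliffordMap Q x = cliffordMap P (A x) := by
  obtain ⟨A, hA⟩ := h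
  refine ⟨A.symm, fun x => ?_⟩
  ext i
  calc ⟪Q i x, x⟫ = ⟪A.symm (A (P i (A.symm x))), A.symm x⟫ := by
        rw [hA, A.symm.inner_map_map]
    _ = ⟪P i (A.symm x), A.symm x⟫ := by rw [A.symm_apply_apply]

end AlgebraicallyEquivalent

namespace IsCliffordSystem

variable {P P' : Fin 3 → End ℝ (EuclideanSpace ℝ (Fin 4))}

theorem isIrreducibleSystem (hP : IsCliffordSystem P) : IsIrreducibleSystem P := by
  obtain ⟨hweak, hsq⟩ := isCliffordSystem_iff.1 hP
  rintro ⟨U, W, hU, hW, hUW, hinv⟩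
  obtain ⟨u, huU, hu⟩ := U.exists_mem_ne_zero_of_ne_bot hU
  have hU_top := hweak.eq_top_of_invariant (by simp) (fun i => (hinv i).1) huU hu (hsq 0 u)
  rw [hU_top] at hUW
  exact hW (eq_bot_of_isCompl_top hUW.symm)

theorem algebraicallyEquivalent_hopfSystem (hP : IsCliffordSystem P) :
    AlgebraicallyEquivalent hopfSystem P := by
  obtain ⟨hweak, hsq⟩ := isCliffordSystem_iff.1 hP
  obtain ⟨u, hu⟩ := exists_ne (0 : EuclideanSpace ℝ (Fin 4))
  obtain ⟨v, -, hv1, hv⟩ :=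
    hweak.exists_fixed_unit_mem (U := ⊤) (by simp) trivial hu (hsq 0 u)
  let b := OrthonormalBasis.mk (hweak.orthonormal_frame hv hv1)
    (hweak.span_frame_eq_top (by simp) hv hv1).ge
  have intertwines (i : Fin 3) : P i ∘ₗ b.repr.symm.toLinearEquiv.toLinearMap =
      b.repr.symm.toLinearEquiv.toLinearMap ∘ₗ hopfSystem i := by
    refine (EuclideanSpace.basisFun (Fin 4) ℝ).toBasis.ext fun j => ?_
    calc P i (b.repr.symm (EuclideanSpace.basisFun (Fin 4) ℝ j)) = P i (b j) := by simp
      _ = ∑ k, hopfMatrix i k j • b k := by simp [b, hweak.apply_frame hv]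
      _ = b.repr.symm (hopfSystem i (EuclideanSpace.basisFun (Fin 4) ℝ j)) := by
        simp [← b.sum_repr_symm, hopfSystem, Matrix.toLpLin_apply]
  refine ⟨b.repr.symm, fun i x => ?_⟩
  simpa using LinearMap.congr_fun (intertwines i) (b.repr x)

theorem algebraicallyEquivalent (hP : IsCliffordSystem P) (hP' : IsCliffordSystem P') :
    AlgebraicallyEquivalent P P' :=
  hP.algebraicallyEquivalent_hopfSystem.symm.trans hP'.algebraicallyEquivalent_hopfSystem

theorem exists_cliffordMap_eq_hopfMap (hP : IsCliffordSystem P) :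
    ∃ A : EuclideanSpace ℝ (Fin 4) ≃ₗᵢ[ℝ] EuclideanSpace ℝ (Fin 4),
      ∀ x, cliffordMap P x = hopfMap (A x) := by
  simpa only [cliffordMap_hopfSystem] using
    hP.algebraicallyEquivalent_hopfSystem.exists_cliffordMap_eq

end IsCliffordSystem

section Sphere

variable {m n : ℕ} {ψ : UnitSphere m → UnitSphere n}
  {Φ : EuclideanSpace ℝ (Fin (m + 1)) → EuclideanSpace ℝ (Fin (n + 1))}

theorem radialExtension_of_ne_zero (f : UnitSphere n → ℝ) {y : EuclideanSpace ℝ (Fin (n + 1))}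
    (hy : y ≠ 0) : radialExtension f y = f ⟨‖y‖⁻¹ • y, by simp [norm_smul, hy]⟩ := by
  simp [radialExtension, hy]

theorem radialExtension_smul_coe (f : UnitSphere n → ℝ) {t : ℝ} (ht : 0 < t) (x : UnitSphere n) :
    radialExtension f (t • (x : EuclideanSpace ℝ (Fin (n + 1)))) = f x := by
  have hx : (x : EuclideanSpace ℝ (Fin (n + 1))) ≠ 0 := ne_zero_of_mem_unit_sphere x
  rw [radialExtension_of_ne_zero f (smul_ne_zero ht.ne' hx)]
  congr
  simp [norm_smul, abs_of_pos ht, smul_smul, ht.ne']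

theorem radialExtension_comp {d : ℕ} (hd : d ≠ 0) (hΦ : ∀ (t : ℝ) x, Φ (t • x) = t ^ d • Φ x)
    (hψ : ∀ x : UnitSphere m, (ψ x : EuclideanSpace ℝ (Fin (n + 1))) = Φ x)
    (f : UnitSphere n → ℝ) : radialExtension (f ∘ ψ) = radialExtension f ∘ Φ := by
  ext y
  by_cases hy : y = 0
  · have map_zero : Φ 0 = 0 := by simpa [hd] using hΦ 0 0
    simp [hy, map_zero, radialExtension]
  · let x : UnitSphere m := ⟨‖y‖⁻¹ • y, by simp [norm_smul, hy]⟩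
    have map_eq : Φ y = ‖y‖ ^ d • ψ x := by
      rw [hψ, ← hΦ, smul_inv_smul₀ (norm_ne_zero_iff.2 hy)]
    rw [radialExtension_of_ne_zero _ hy, Function.comp_apply, Function.comp_apply, map_eq,
      radialExtension_smul_coe f (by positivity)]

theorem contMDiff_unitSphere_of_contDiff (hΦ : ContDiff ℝ ∞ Φ)
    (hψ : ∀ x : UnitSphere m, (ψ x : EuclideanSpace ℝ (Fin (n + 1))) = Φ x) :
    ContMDiff (𝓡 m) (𝓡 n) ∞ ψ := by
  have (k : ℕ) : Fact (finrank ℝ (EuclideanSpace ℝ (Fin (k + 1))) = k + 1) := ⟨by simp⟩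
  have contMDiff_coe : ContMDiff (𝓡 m) 𝓘(ℝ, EuclideanSpace ℝ (Fin (n + 1))) ∞
      fun x : UnitSphere m => (ψ x : EuclideanSpace ℝ (Fin (n + 1))) := by
    simp only [hψ]
    exact hΦ.contMDiff.comp contMDiff_coe_sphere
  exact contMDiff_coe.codRestrict_sphere fun x => (ψ x).2

theorem IsHarmonicMorphism.isSphereHarmonicMorphism (hΦ : IsHarmonicMorphism Φ) {d : ℕ}
    (hd : d ≠ 0) (hΦd : ∀ (t : ℝ) x, Φ (t • x) = t ^ d • Φ x)
    (hψ : ∀ x : UnitSphere m, (ψ x : EuclideanSpace ℝ (Fin (n + 1))) = Φ x) :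
    IsSphereHarmonicMorphism ψ := by
  refine ⟨contMDiff_unitSphere_of_contDiff hΦ.1 hψ, fun V f _ hf x hx => ?_⟩
  have harmonicAt_image : HarmonicAt (radialExtension f) (Φ x) := hψ x ▸ hf (ψ x) hx
  rw [radialExtension_comp hd hΦd hψ]
  exact hΦ.2 _ _ (isOpen_setOfPred_harmonicAt _) (fun _ hy => hy) _ harmonicAt_image

/-- The isometry of the unit sphere induced by a linear isometry. -/
noncomputable def unitSphereIsometryEquiv
    (A : EuclideanSpace ℝ (Fin (n + 1)) ≃ₗᵢ[ℝ] EuclideanSpace ℝ (Fin (n + 1))) :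
    UnitSphere n ≃ᵢ UnitSphere n where
  toFun x := ⟨A x, by simp⟩
  invFun x := ⟨A.symm x, by simp⟩
  left_inv x := by simp
  right_inv x := by simp
  isometry_toFun := Isometry.of_dist_eq fun x y => A.dist_map x y

end Sphere

theorem corollary3p6 :
    -- After a homothety, each quadratic harmonic morphism comes from an irreducible Clifford
    -- system and restricts to a harmonic morphism bi-equivalent to the Hopf fibration.
    (∀ φ : EuclideanSpace ℝ (Fin 4) → EuclideanSpace ℝ (Fin 3),
      IsQuadraticHarmonicMorphism φ →
      ∃ r : ℝ, 0 < r ∧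
        (∃ P : Fin 3 → Module.End ℝ (EuclideanSpace ℝ (Fin 4)),
          IsCliffordSystem P ∧ IsIrreducibleSystem P ∧ ∀ x, φ (r • x) = cliffordMap P x) ∧
        ∃ ψ : UnitSphere 3 → UnitSphere 2,
          (∀ x : UnitSphere 3,
            (ψ x : EuclideanSpace ℝ (Fin 3)) = φ (r • (x : EuclideanSpace ℝ (Fin 4)))) ∧
          IsSphereHarmonicMorphism ψ ∧ BiEquivalent ψ hopfFibration) ∧
    -- The Clifford systems that occur are all algebraically equivalent.
    (∀ φ φ' : EuclideanSpace ℝ (Fin 4) → EuclideanSpace ℝ (Fin 3),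
      IsQuadraticHarmonicMorphism φ → IsQuadraticHarmonicMorphism φ' →
      ∀ r r' : ℝ, 0 < r → 0 < r' →
      ∀ P P' : Fin 3 → Module.End ℝ (EuclideanSpace ℝ (Fin 4)),
        IsCliffordSystem P → IsCliffordSystem P' →
        (∀ x, φ (r • x) = cliffordMap P x) → (∀ x, φ' (r' • x) = cliffordMap P' x) →
        AlgebraicallyEquivalent P P') := by
  refine ⟨fun φ hφ => ?_, fun _ _ _ _ _ _ _ _ P P' hP hP' _ _ => hP.algebraicallyEquivalent hP'⟩
  obtain ⟨r, hr, P, hP, hφP⟩ := hφ.exists_isCliffordSystem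
  obtain ⟨A, hA⟩ := hP.exists_cliffordMap_eq_hopfMap
  have harmonic : IsHarmonicMorphism (cliffordMap P) :=
    funext hφP ▸ hφ.isHarmonicMorphism.comp (.const_smul r)
  let ψ : UnitSphere 3 → UnitSphere 2 := hopfFibration ∘ unitSphereIsometryEquiv A
  have coe_ψ (x : UnitSphere 3) : (ψ x : EuclideanSpace ℝ (Fin 3)) = cliffordMap P x := (hA x).symm
  exact ⟨r, hr, ⟨P, hP, hP.isIrreducibleSystem, hφP⟩, ψ, fun x => (coe_ψ x).trans (hφP x).symm,
    harmonic.isSphereHarmonicMorphism two_ne_zero (cliffordMap_smul P) coe_ψ,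
    unitSphereIsometryEquiv A, .refl _, rfl⟩
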